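/- Let $\mathcal{M}$ be a matroid of rank $3$ on a finite ground set $X$, and let $$\operatorname{Rel}_{\mathcal{M}}(q)=\sum_{I} q^{|I|}(1-q)^{|X\setminus I|},$$ where the sum is over all independent sets $I$ of $\mathcal{M}$, be its reliability polynomial. Then every complex root $z$ of $\operatorname{Rel}_{\mathcal{M}}$ satisfies $|z|\le 1$. -/

import Mathlib

open scoped Classical in
/-- The reliability polynomial of a finite matroid `M` on the ground set `E`: the sum of
`q ^ |I| * (1 - q) ^ |E \ I|` over the independent sets `I` of `M` (the faces of the complex),
as a polynomial in `q` with complex coefficients. -/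
noncomputable def Matroid.reliability {α : Type*} (M : Matroid α) [M.Finite] : Polynomial ℂ :=
  ∑ I ∈ M.ground_finite.toFinset.powerset.filter (fun I : Finset α => M.Indep (I : Set α)),
    Polynomial.X ^ I.card * (1 - Polynomial.X) ^ (M.ground_finite.toFinset \ I).card

/-! Let m, f, g count the nonloops, the independent pairs and the independent triples. Apart from
the root z = 1, a root of the reliability polynomial is a root of a cubic with coefficients 1, m -
3, f - 2m + 3, g - f + m - 1, the h-vector of the independence complex. An elementary criterion
(`norm_le_one_of_cubic_eq_zero`) puts its roots in the unit disc once m ≥ 4, f ≥ 2m - 2, f ≤ g + 2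
and 2f + 8 ≤ g + 4m.

These inequalities hold unless a line and one parallel class cover all nonloops. They come from
fixing a line L with complement C and sorting pairs and triples by how many of their points lie on
L; ordered counts are used throughout, so 2f and 6g appear. The two hard ones are
`three_mul_pairCount_le` and `six_mul_pairCount_le`.

In the exceptional case the counts are those of a direct sum of ranks one and two. The cubic then
splits into a linear and a quadratic factor, and the quadratic is controlled by a dichotomy for rank
two (`IsApartness.pairCount_eq_or_le`). -/

/-! ### Root location for real quadratics and cubics -/

/-- A real quadratic with nonnegative coefficients `t`, `s`, `1` has no zeros outside the unit disc
if it has degree two, `1 ≤ t` and `s ≤ t + 1`, or if it has degree at most one and `s = 0` or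
`1 ≤ s`. -/
theorem norm_le_one_of_quadratic_eq_zero {s t : ℝ} (hs : s = 0 ∨ 1 ≤ s)
    (h : t = 0 ∨ (1 ≤ t ∧ s ≤ t + 1)) {z : ℂ} (hz : 1 + s * z + t * z ^ 2 = 0) : ‖z‖ ≤ 1 := by
  have hs0 : 0 ≤ s := by rcases hs with h | h <;> linarith
  have hre := congrArg Complex.re hz
  have him := congrArg Complex.im hz
  obtain ⟨x, y⟩ := z
  simp [pow_two] at hre him
  have hnorm : ‖(⟨x, y⟩ : ℂ)‖ ^ 2 = x * x + y * y := by
    rw [Complex.sq_norm, Complex.normSq_apply]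
  suffices hxy : x * x + y * y ≤ 1 by
    nlinarith [norm_nonneg (⟨x, y⟩ : ℂ)]
  by_cases hy : y = 0
  · subst hy
    by_contra hc
    have hx0 : x < 0 := by
      by_contra hx
      have : 0 ≤ t := by rcases h with h | h <;> linarith
      have : 0 ≤ s * x := mul_nonneg hs0 (by linarith)
      nlinarith [mul_self_nonneg x]
    have hx1 : x < -1 := by nlinarith
    rcases h with rfl | ⟨h1, h2⟩
    · rcases hs with rfl | hs
      · linarith
      · nlinarith
    -- With w = -x > 1, the value 1 - s w + t w² is at least (w - 1)(t w - 1) > 0, because s ≤ t +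
    -- 1.
    · nlinarith [mul_pos (show 0 < -x - 1 by linarith) (show 0 < t * (-x) - 1 by nlinarith)]
  · have h1 : s + 2 * t * x = 0 := by
      have : y * (s + 2 * t * x) = 0 := by linear_combination him
      exact (mul_eq_zero.mp this).resolve_left hy
    -- The roots are conjugate, with product 1 / t.
    have h2 : t * (x * x + y * y) = 1 := by linear_combination -hre + x * h1
    rcases h with rfl | ⟨h, -⟩
    · linarith
    · nlinarith [mul_self_nonneg x, mul_self_nonneg y]

/-- A criterion for a real cubic with constant coefficient one to have all its zeros in the
closed unit disc. -/
theorem norm_le_one_of_cubic_eq_zero {a b c : ℝ} (ha : 1 ≤ a) (hb : 1 ≤ b) (hac : a ≤ c)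
    (habc : b + 1 ≤ c + a) {z : ℂ} (hz : 1 + a * z + b * z ^ 2 + c * z ^ 3 = 0) : ‖z‖ ≤ 1 := by
  have hre := congrArg Complex.re hz
  have him := congrArg Complex.im hz
  obtain ⟨x, y⟩ := z
  simp [pow_succ] at hre him
  have hnorm : ‖(⟨x, y⟩ : ℂ)‖ ^ 2 = x * x + y * y := by
    rw [Complex.sq_norm, Complex.normSq_apply]
  suffices hxy : x * x + y * y ≤ 1 by
    nlinarith [norm_nonneg (⟨x, y⟩ : ℂ)]
  by_contra hc
  by_cases hy : y = 0
  · subst hy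
    have hx0 : x < 0 := by
      by_contra hx
      have hx : 0 ≤ x := by linarith
      have h1 : 0 ≤ a * x := by positivity
      have h2 : 0 ≤ b * (x * x) := by positivity
      have h3 : 0 ≤ c * (x * x * x) := mul_nonneg (by linarith) (by positivity)
      linarith
    obtain ⟨w, rfl⟩ : ∃ w, x = -w := ⟨-x, by ring⟩
    have hw : 1 < w := by nlinarith
    -- Since b ≤ a + c - 1, the cubic at -w is at most -(w - 1)(c w² - a w + w + 1), so positivity
    -- of the second factor suffices.
    have h1 : 0 < c * w ^ 2 - a * w + w + 1 := by
      have : 0 ≤ c * w ^ 2 - a * w ^ 2 := by nlinarith [sq_nonneg w]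
      have : 0 ≤ a * w * (w - 1) := mul_nonneg (by nlinarith) (by linarith)
      nlinarith
    have h2 := mul_pos (show 0 < w - 1 by linarith) h1
    nlinarith [mul_nonneg (sub_nonneg.mpr habc) (sq_nonneg w)]
  · have h1 : a + 2 * b * x + c * (3 * (x * x) - y * y) = 0 := by
      have : y * (a + 2 * b * x + c * (3 * (x * x) - y * y)) = 0 := by linear_combination him
      exact (mul_eq_zero.mp this).resolve_left hy
    set r := x * x + y * y with hr
    have h2 : (b + 2 * c * x) * r = 1 := by
      rw [hr]; linear_combination -hre + x * h1
    have h3 : a = c * r - (b + 2 * c * x) * (2 * x) := by rw [hr]; linear_combination h1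
    -- The roots have product -1 / c, so the third one is -1 / (c r); this is the cubic at that
    -- point, cleared of denominators. For r > 1 it is positive, as c r ≥ a and b r > 1.
    have h4 : c ^ 2 * r ^ 3 - a * c * r ^ 2 + b * r - 1 = 0 := by
      generalize hk : b + 2 * c * x = k at h2 h3
      have hb' : b = k - 2 * c * x := by linarith
      rw [hb', h3]
      linear_combination (1 + 2 * c * x * r) * h2
    push Not at hc
    have h5 : 0 ≤ c * r ^ 2 * (c * r - a) :=
      mul_nonneg (mul_nonneg (by linarith) (by positivity)) (by nlinarith)
    nlinarith

/-! ### Ordered pair and triple counts -/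

open scoped Classical in
/-- The number of pairs `(x, y)` in `A × B` with `D x y`. -/
noncomputable def pairCount {α : Type*} (D : α → α → Prop) (A B : Finset α) : ℤ :=
  ∑ x ∈ A, ∑ y ∈ B, if D x y then 1 else 0

open scoped Classical in
/-- The number of triples `(x, y, z)` in `A × B × C` with `T x y z`. -/
noncomputable def tripleCount {α : Type*} (T : α → α → α → Prop) (A B C : Finset α) : ℤ :=
  ∑ x ∈ A, ∑ y ∈ B, ∑ z ∈ C, if T x y z then 1 else 0

section Counting

open scoped Classical
open Finset

variable {α : Type*} {D : α → α → Prop} {T : α → α → α → Prop} {A B C : Finset α}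

theorem pairCount_nonneg : 0 ≤ pairCount D A B :=
  sum_nonneg fun _ _ => sum_nonneg fun _ _ => by split_ifs <;> simp

theorem tripleCount_nonneg : 0 ≤ tripleCount T A B C :=
  sum_nonneg fun _ _ => sum_nonneg fun _ _ => sum_nonneg fun _ _ => by split_ifs <;> simp

theorem pairCount_eq_sum_card : pairCount D A B = ∑ x ∈ A, (#{y ∈ B | D x y} : ℤ) :=
  sum_congr rfl fun _ _ => by simp

theorem tripleCount_eq_sum_card :
    tripleCount T A B C = ∑ x ∈ A, ∑ y ∈ B, (#{z ∈ C | T x y z} : ℤ) :=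
  sum_congr rfl fun _ _ => sum_congr rfl fun _ _ => by simp

theorem pairCount_split_left (p : α → Prop) :
    pairCount D A B = pairCount D {x ∈ A | p x} B + pairCount D {x ∈ A | ¬ p x} B :=
  (sum_filter_add_sum_filter_not A p _).symm

theorem pairCount_comm (hD : ∀ x y, D x y → D y x) : pairCount D A B = pairCount D B A := by
  unfold pairCount
  rw [sum_comm]
  refine sum_congr rfl fun x _ => sum_congr rfl fun y _ => ?_
  rw [show D x y ↔ D y x from ⟨hD _ _, hD _ _⟩]

theorem pairCount_split (hD : ∀ x y, D x y → D y x) (p : α → Prop) :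
    pairCount D A A = pairCount D {x ∈ A | p x} {x ∈ A | p x} +
      2 * pairCount D {x ∈ A | p x} {x ∈ A | ¬ p x} +
      pairCount D {x ∈ A | ¬ p x} {x ∈ A | ¬ p x} := by
  rw [pairCount_split_left p, pairCount_comm hD (B := A), pairCount_split_left p,
    pairCount_comm hD (A := {x ∈ A | ¬ p x}) (B := A), pairCount_split_left p (B := {x ∈ A | ¬ p x}),
    pairCount_comm hD (A := {x ∈ A | ¬ p x}) (B := {x ∈ A | p x})]
  ring

theorem pairCount_eq_mul (h : ∀ x ∈ A, ∀ y ∈ B, D x y) : pairCount D A B = #A * #B := by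
  unfold pairCount
  rw [sum_congr rfl fun x hx => sum_congr rfl fun y hy => if_pos (h x hx y hy)]
  simp

theorem pairCount_eq_zero (h : ∀ x ∈ A, ∀ y ∈ B, ¬ D x y) : pairCount D A B = 0 :=
  sum_eq_zero fun x hx => sum_eq_zero fun y hy => if_neg (h x hx y hy)

theorem pairCount_of_ne (h : ∀ x ∈ A, ∀ y ∈ A, D x y ↔ x ≠ y) :
    pairCount D A A = #A * (#A - 1) := by
  rw [pairCount_eq_sum_card, sum_congr rfl (g := fun _ => (#A - 1 : ℤ)) fun x hx => ?_]
  · rw [sum_const, nsmul_eq_mul]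
  · rw [show {y ∈ A | D x y} = A.erase x by ext y; simp; grind, card_erase_of_mem hx,
      Nat.cast_sub (card_pos.mpr ⟨x, hx⟩), Nat.cast_one]

theorem tripleCount_split_left (p : α → Prop) :
    tripleCount T A B C = tripleCount T {x ∈ A | p x} B C + tripleCount T {x ∈ A | ¬ p x} B C :=
  (sum_filter_add_sum_filter_not A p _).symm

theorem tripleCount_swap_left (hT : ∀ x y z, T x y z → T y x z) :
    tripleCount T A B C = tripleCount T B A C := by
  unfold tripleCount
  rw [sum_comm]
  refine sum_congr rfl fun x _ => sum_congr rfl fun y _ => sum_congr rfl fun z _ => ?_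
  rw [show T x y z ↔ T y x z from ⟨hT _ _ _, hT _ _ _⟩]

theorem tripleCount_swap_right (hT : ∀ x y z, T x y z → T x z y) :
    tripleCount T A B C = tripleCount T A C B := by
  unfold tripleCount
  refine sum_congr rfl fun x _ => ?_
  rw [sum_comm]
  refine sum_congr rfl fun y _ => sum_congr rfl fun z _ => ?_
  rw [show T x y z ↔ T x z y from ⟨hT _ _ _, hT _ _ _⟩]

theorem tripleCount_split (h₁ : ∀ x y z, T x y z → T y x z) (h₂ : ∀ x y z, T x y z → T x z y)
    (p : α → Prop) :
    tripleCount T A A A =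
      tripleCount T {x ∈ A | p x} {x ∈ A | p x} {x ∈ A | p x} +
      3 * tripleCount T {x ∈ A | p x} {x ∈ A | p x} {x ∈ A | ¬ p x} +
      3 * tripleCount T {x ∈ A | ¬ p x} {x ∈ A | ¬ p x} {x ∈ A | p x} +
      tripleCount T {x ∈ A | ¬ p x} {x ∈ A | ¬ p x} {x ∈ A | ¬ p x} := by
  set P := {x ∈ A | p x} with hP
  set Q := {x ∈ A | ¬ p x} with hQ
  have split (B C) : tripleCount T A B C = tripleCount T P B C + tripleCount T Q B C :=
    tripleCount_split_left p
  have s₁ (A B C) : tripleCount T A B C = tripleCount T B A C := tripleCount_swap_left h₁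
  have s₂ (A B C) : tripleCount T A B C = tripleCount T A C B := tripleCount_swap_right h₂
  -- Of the eight blocks of A³, those with equally many factors P agree by symmetry.
  linarith [split A A, split P A, split Q A, split P P, split P Q, split Q Q, s₁ P A A, s₁ Q A A,
    s₁ Q P A, s₂ P P A, s₁ P A P, s₂ P Q A, s₁ P A Q, s₂ Q Q A, s₁ Q A Q, s₁ Q P P, s₂ P Q P,
    s₂ Q P Q, s₁ P Q Q]

theorem tripleCount_eq_pairCount_mul {k : ℤ}
    (h : ∀ x ∈ A, ∀ y ∈ B, D x y → (#{z ∈ C | T x y z} : ℤ) = k)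
    (h' : ∀ x y z, T x y z → D x y) : tripleCount T A B C = pairCount D A B * k := by
  rw [tripleCount_eq_sum_card, pairCount, sum_mul]
  refine sum_congr rfl fun x hx => ?_
  rw [sum_mul]
  refine sum_congr rfl fun y hy => ?_
  split_ifs with hd
  · rw [h x hx y hy hd, one_mul]
  · rw [zero_mul, Nat.cast_eq_zero, card_eq_zero, filter_eq_empty_iff]
    exact fun z _ ht => hd (h' _ _ _ ht)

theorem pairCount_mul_le_tripleCount {k : ℤ}
    (h : ∀ x ∈ A, ∀ y ∈ B, D x y → k ≤ (#{z ∈ C | T x y z} : ℤ)) :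
    pairCount D A B * k ≤ tripleCount T A B C := by
  rw [tripleCount_eq_sum_card, pairCount, sum_mul]
  refine sum_le_sum fun x hx => ?_
  rw [sum_mul]
  refine sum_le_sum fun y hy => ?_
  split_ifs with hd
  · rw [one_mul]; exact h x hx y hy hd
  · rw [zero_mul]; positivity

/-! ### Apartness relations: counting in rank two -/

/-- `D` is the complement of an equivalence relation on the finite set `L`. -/
structure IsApartness (D : α → α → Prop) (L : Finset α) : Prop where
  symm : ∀ x y, D x y → D y x
  irrefl : ∀ x, ¬ D x x
  cotrans : ∀ x ∈ L, ∀ y ∈ L, ∀ z ∈ L, D x z → D x y ∨ D y z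

namespace IsApartness

variable {L : Finset α}

theorem mono (h : IsApartness D L) {L' : Finset α} (hL : L' ⊆ L) : IsApartness D L' :=
  ⟨h.symm, h.irrefl, fun x hx y hy z hz => h.cotrans x (hL hx) y (hL hy) z (hL hz)⟩

/-- Removing one equivalence class. -/
theorem pairCount_eq (h : IsApartness D L) {x : α} (hx : x ∈ L) :
    pairCount D L L = 2 * (#{y ∈ L | ¬ D x y} * #{y ∈ L | D x y}) +
      pairCount D {y ∈ L | D x y} {y ∈ L | D x y} := by
  rw [pairCount_split h.symm (D x), pairCount_comm h.symm (A := {y ∈ L | D x y})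
    (B := {y ∈ L | ¬ D x y}), pairCount_eq_mul (A := {y ∈ L | ¬ D x y}) (B := {y ∈ L | D x y}),
    pairCount_eq_zero (A := {y ∈ L | ¬ D x y}) (B := {y ∈ L | ¬ D x y})]
  · ring
  · intro y hy z hz hyz
    simp only [mem_filter] at hy hz
    rcases h.cotrans y hy.1 x hx z hz.1 hyz with h' | h'
    exacts [hy.2 (h.symm _ _ h'), hz.2 h']
  · intro y hy z hz
    simp only [mem_filter] at hy hz
    exact (h.cotrans x hx y hy.1 z hz.1 hz.2).resolve_left hy.2

theorem card_eq (x : α) : (#L : ℤ) = #{y ∈ L | ¬ D x y} + #{y ∈ L | D x y} := by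
  rw [← card_filter_add_card_filter_not (s := L) (D x)]; push_cast; ring

theorem one_le_card (h : IsApartness D L) {x : α} (hx : x ∈ L) :
    (1 : ℤ) ≤ #{y ∈ L | ¬ D x y} := by
  exact_mod_cast card_pos.mpr ⟨x, by simp [hx, h.irrefl]⟩

/-- The class of x, of size α, and its complement, of size β, are nonempty, and 2αβ ≥ 2(α + β - 1).
-/
theorem le_pairCount (h : IsApartness D L) {x y : α} (hx : x ∈ L) (hy : y ∈ L) (hxy : D x y) :
    2 * (#L - 1 : ℤ) ≤ pairCount D L L := by
  have hA := h.one_le_card hx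
  have hB : (1 : ℤ) ≤ #{y ∈ L | D x y} := by
    exact_mod_cast card_pos.mpr ⟨y, by simp [hy, hxy]⟩
  rw [h.pairCount_eq hx, card_eq x (D := D)]
  nlinarith [pairCount_nonneg (D := D) (A := {y ∈ L | D x y}) (B := {y ∈ L | D x y})]

/-- If every element is apart from at least two others, there are many pairs. -/
theorem le_pairCount_of_two_le (h : IsApartness D L)
    (h₂ : ∀ x ∈ L, 2 ≤ #{y ∈ L | D x y}) : 4 * (#L - 2 : ℤ) ≤ pairCount D L L := by
  -- A class with at least two elements has at least two elements outside it, and (α - 2)(β - 2) ≥ 0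
  -- suffices. Otherwise all classes are singletons and the bound is n(n - 1) ≥ 4(n - 2).
  by_cases hs : ∃ x ∈ L, (2 : ℤ) ≤ #{y ∈ L | ¬ D x y}
  · obtain ⟨x, hx, hA⟩ := hs
    have hB : (2 : ℤ) ≤ #{y ∈ L | D x y} := by exact_mod_cast h₂ x hx
    rw [h.pairCount_eq hx, card_eq x (D := D)]
    nlinarith [pairCount_nonneg (D := D) (A := {y ∈ L | D x y}) (B := {y ∈ L | D x y})]
  · push Not at hs
    rw [pairCount_of_ne]
    · nlinarith [sq_nonneg (2 * (#L : ℤ) - 5)]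
    · intro x hx y hy
      refine ⟨fun hd he => h.irrefl x (he ▸ hd), fun hne => ?_⟩
      by_contra hd
      have : 1 < #{y ∈ L | ¬ D x y} :=
        one_lt_card.mpr ⟨x, by simp [hx, h.irrefl], y, by simp [hy, hd], hne⟩
      have := hs x hx
      omega

/-- An element apart from exactly one other forces two classes, one of them a singleton, which is
the first alternative. In rank two the alternatives say that the top h-number vanishes or is large
enough for the quadratic criterion. -/
theorem pairCount_eq_or_le (h : IsApartness D L) {x y : α} (hx : x ∈ L) (hy : y ∈ L)
    (hxy : D x y) :
    pairCount D L L = 2 * (#L - 1 : ℤ) ∨ 4 * (#L - 2 : ℤ) ≤ pairCount D L L := by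
  by_cases h₂ : ∀ x ∈ L, 2 ≤ #{y ∈ L | D x y}
  · exact .inr (h.le_pairCount_of_two_le h₂)
  · push Not at h₂
    obtain ⟨z, hz, hlt⟩ := h₂
    have hpos : 0 < #{y ∈ L | D z y} := by
      rcases h.cotrans x hx z hz y hy hxy with h' | h'
      exacts [card_pos.mpr ⟨x, by simp [hx, h.symm _ _ h']⟩, card_pos.mpr ⟨y, by simp [hy, h']⟩]
    have h₁ : #{y ∈ L | D z y} = 1 := by omega
    left
    have hc := card_eq (L := L) (D := D) z
    rw [h₁] at hc
    rw [h.pairCount_eq hz, hc, h₁, pairCount_eq_zero]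
    · push_cast; ring
    · obtain ⟨w, hw⟩ := card_eq_one.mp h₁
      rw [hw]
      simp [h.irrefl]

end IsApartness

end Counting

/-! ### Lines in rank three: the counting inequalities -/

section PointLine

open scoped Classical
open Finset

variable {α : Type*} {D : α → α → Prop} {T : α → α → α → Prop} {S : Finset α}

/-- The relations "`x, y` are distinct and independent" and "`x, y, z` are distinct and
independent" on the nonloops of a matroid, with the properties needed for counting. The set
of all `z` with `¬ T x y z` is the line spanned by `x` and `y`. -/
structure IsPointLineGeometry (D : α → α → Prop) (T : α → α → α → Prop) (S : Finset α) : Prop where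
  apart : IsApartness D S
  swap_left : ∀ x y z, T x y z → T y x z
  swap_right : ∀ x y z, T x y z → T x z y
  pair_of_triple : ∀ x y z, T x y z → D x y
  line_eq : ∀ x ∈ S, ∀ y ∈ S, ∀ u ∈ S, ∀ v ∈ S, D x y → D u v → ¬ T x y u → ¬ T x y v →
    ∀ w ∈ S, T u v w ↔ T x y w

/-- No line together with one parallel class covers the ground set. -/
def NotLineUnionPoint (D : α → α → Prop) (T : α → α → α → Prop) (S : Finset α) : Prop :=
  ∀ u ∈ S, ∀ v ∈ S, ∀ x ∈ S, D u v → ∃ z ∈ S, T u v z ∧ D x z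

namespace IsPointLineGeometry

variable {x y u v w w' : α}

theorem not_triple_left (h : IsPointLineGeometry D T S) (x y : α) : ¬ T x y x := fun ht =>
  h.apart.irrefl x (h.pair_of_triple _ _ _ (h.swap_right _ _ _ ht))

theorem not_triple_right (h : IsPointLineGeometry D T S) (x y : α) : ¬ T x y y := fun ht =>
  h.not_triple_left y x (h.swap_left _ _ _ ht)

/-- A point u of the line is apart from x or from y and together with it spans the same line, so v
completes an independent triple containing u. -/
theorem apart_of_not_triple (h : IsPointLineGeometry D T S) (hx : x ∈ S) (hy : y ∈ S)
    (hu : u ∈ S) (hv : v ∈ S) (hxy : D x y) (hT : ¬ T x y u) (hT' : T x y v) : D u v := by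
  rcases h.apart.cotrans x hx u hu y hy hxy with hd | hd
  · have := (h.line_eq x hx y hy x hx u hu hxy hd (h.not_triple_left _ _) hT v hv).mpr hT'
    exact h.pair_of_triple _ _ _ (h.swap_right _ _ _ (h.swap_left _ _ _ this))
  · have := (h.line_eq x hx y hy u hu y hy hxy hd hT (h.not_triple_right _ _) v hv).mpr hT'
    exact h.pair_of_triple _ _ _ (h.swap_right _ _ _ this)

/-- Two different lines meet in at most one parallel class. -/
theorem not_apart_of_mem_inter (h : IsPointLineGeometry D T S) (hx : x ∈ S) (hy : y ∈ S)
    (hu : u ∈ S) (hv : v ∈ S) (hw : w ∈ S) (hw' : w' ∈ S) (hxy : D x y) (huv : D u v)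
    (hxyu : T x y u) (h₁ : ¬ T x y w) (h₂ : ¬ T x y w') (h₃ : ¬ T u v w) (h₄ : ¬ T u v w') :
    ¬ D w w' := fun hd =>
  h.not_triple_left u v <|
    (h.line_eq u hu v hv w hw w' hw' huv hd h₃ h₄ u hu).mp <|
      (h.line_eq x hx y hy w hw w' hw' hxy hd h₁ h₂ u hu).mpr hxyu

theorem card_eq (x y : α) : (#S : ℤ) = #{z ∈ S | ¬ T x y z} + #{z ∈ S | T x y z} := by
  rw [← card_filter_add_card_filter_not (s := S) (T x y)]; push_cast; ring

/-- A point on a line is apart from every point off it, so the mixed block is full. -/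
theorem pairCount_eq_line (h : IsPointLineGeometry D T S) (hx : x ∈ S) (hy : y ∈ S)
    (hxy : D x y) :
    pairCount D S S = pairCount D {z ∈ S | ¬ T x y z} {z ∈ S | ¬ T x y z} +
      2 * (#{z ∈ S | ¬ T x y z} * #{z ∈ S | T x y z}) +
      pairCount D {z ∈ S | T x y z} {z ∈ S | T x y z} := by
  rw [pairCount_split h.apart.symm (T x y), pairCount_comm h.apart.symm (A := {z ∈ S | T x y z})
    (B := {z ∈ S | ¬ T x y z}), pairCount_eq_mul (A := {z ∈ S | ¬ T x y z})
    (B := {z ∈ S | T x y z})]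
  · ring
  · intro a ha b hb
    simp only [mem_filter] at ha hb
    exact h.apart_of_not_triple hx hy ha.1 hb.1 hxy ha.2 hb.2

/-- Two apart points of the line span it, so they form a triple with every point off it and with
none on it. -/
theorem tripleCount_eq_line (h : IsPointLineGeometry D T S) (hx : x ∈ S) (hy : y ∈ S)
    (hxy : D x y) :
    tripleCount T S S S =
      3 * (pairCount D {z ∈ S | ¬ T x y z} {z ∈ S | ¬ T x y z} * #{z ∈ S | T x y z}) +
      3 * tripleCount T {z ∈ S | T x y z} {z ∈ S | T x y z} {z ∈ S | ¬ T x y z} +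
      tripleCount T {z ∈ S | T x y z} {z ∈ S | T x y z} {z ∈ S | T x y z} := by
  rw [tripleCount_split h.swap_left h.swap_right (T x y),
    tripleCount_eq_pairCount_mul (D := D) (A := {z ∈ S | ¬ T x y z}) (B := {z ∈ S | ¬ T x y z})
      (C := {z ∈ S | ¬ T x y z}) (k := 0) _ h.pair_of_triple,
    tripleCount_eq_pairCount_mul (D := D) (A := {z ∈ S | ¬ T x y z}) (B := {z ∈ S | ¬ T x y z})
      (C := {z ∈ S | T x y z}) (k := #{z ∈ S | T x y z}) _ h.pair_of_triple]
  · ring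
  · intro a ha b hb hab
    simp only [mem_filter] at ha hb
    rw [filter_true_of_mem]
    intro c hc
    simp only [mem_filter] at hc
    exact (h.line_eq x hx y hy a ha.1 b hb.1 hxy hab ha.2 hb.2 c hc.1).mpr hc.2
  · intro a ha b hb hab
    simp only [mem_filter] at ha hb
    rw [Nat.cast_eq_zero, card_eq_zero, filter_eq_empty_iff]
    intro c hc
    simp only [mem_filter] at hc
    exact fun ht => hc.2 ((h.line_eq x hx y hy a ha.1 b hb.1 hxy hab ha.2 hb.2 c hc.1).mp ht)

/-- If the complement of a line is contained in a parallel class, the counts are those of a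
direct sum of matroids of ranks one and two. -/
theorem counts_of_line_union_point (h : IsPointLineGeometry D T S) (hu : u ∈ S) (hv : v ∈ S)
    (hx : x ∈ S) (huv : D u v) (hcov : ∀ z ∈ S, T u v z → ¬ D x z) :
    pairCount D S S = pairCount D {z ∈ S | ¬ T u v z} {z ∈ S | ¬ T u v z} +
      2 * (#{z ∈ S | ¬ T u v z} * #{z ∈ S | T u v z}) ∧
    tripleCount T S S S =
      3 * (pairCount D {z ∈ S | ¬ T u v z} {z ∈ S | ¬ T u v z} * #{z ∈ S | T u v z}) := by
  have hD : pairCount D {z ∈ S | T u v z} {z ∈ S | T u v z} = 0 := by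
    refine pairCount_eq_zero fun a ha b hb hab => ?_
    simp only [mem_filter] at ha hb
    rcases h.apart.cotrans a ha.1 x hx b hb.1 hab with h' | h'
    exacts [hcov a ha.1 ha.2 (h.apart.symm _ _ h'), hcov b hb.1 hb.2 h']
  have hT (C : Finset α) : tripleCount T {z ∈ S | T u v z} {z ∈ S | T u v z} C = 0 := by
    refine le_antisymm ?_ tripleCount_nonneg
    rw [tripleCount_eq_sum_card]
    refine sum_nonpos fun a ha => sum_nonpos fun b hb => ?_
    simp only [mem_filter] at ha hb
    rw [Nat.cast_nonpos, card_eq_zero, filter_eq_empty_iff]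
    intro c _ ht
    rcases h.apart.cotrans a ha.1 x hx b hb.1 (h.pair_of_triple _ _ _ ht) with h' | h'
    exacts [hcov a ha.1 ha.2 (h.apart.symm _ _ h'), hcov b hb.1 hb.2 h']
  rw [h.pairCount_eq_line hu hv huv, h.tripleCount_eq_line hu hv huv, hD, hT, hT]
  constructor <;> ring

theorem exists_apart_not_mem_line (hc : NotLineUnionPoint D T S) (hx : x ∈ S) (hy : y ∈ S)
    (hxy : D x y) : ∃ u ∈ S, ∃ v ∈ S, T x y u ∧ T x y v ∧ D u v := by
  obtain ⟨u, hu, hTu, -⟩ := hc x hx y hy x hx hxy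
  obtain ⟨v, hv, hTv, huv⟩ := hc x hx y hy u hu hxy
  exact ⟨u, hu, v, hv, hTu, hTv, huv⟩

theorem two_le_card_compl_line (h : IsPointLineGeometry D T S) (hc : NotLineUnionPoint D T S)
    (hx : x ∈ S) (hy : y ∈ S) (hxy : D x y) : 2 ≤ #{z ∈ S | T x y z} := by
  obtain ⟨u, hu, v, hv, hTu, hTv, huv⟩ := exists_apart_not_mem_line hc hx hy hxy
  exact one_lt_card.mpr ⟨u, by simp [*], v, by simp [*], fun he => h.apart.irrefl u (he ▸ huv)⟩

theorem two_le_card_line (h : IsPointLineGeometry D T S) (hx : x ∈ S) (hy : y ∈ S)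
    (hxy : D x y) : 2 ≤ #{z ∈ S | ¬ T x y z} :=
  one_lt_card.mpr ⟨x, by simp [hx, h.not_triple_left], y, by simp [hy, h.not_triple_right],
    fun he => h.apart.irrefl x (he ▸ hxy)⟩

theorem four_le_card (h : IsPointLineGeometry D T S) (hc : NotLineUnionPoint D T S)
    (hx : x ∈ S) (hy : y ∈ S) (hxy : D x y) : (4 : ℤ) ≤ #S := by
  have h₁ := h.two_le_card_compl_line hc hx hy hxy
  have h₂ := h.two_le_card_line hx hy hxy
  rw [card_eq x y (T := T)]
  omega

theorem le_pairCount (h : IsPointLineGeometry D T S) (hc : NotLineUnionPoint D T S)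
    (hx : x ∈ S) (hy : y ∈ S) (hxy : D x y) : 4 * (#S - 1 : ℤ) ≤ pairCount D S S := by
  obtain ⟨u, hu, v, hv, hTu, hTv, huv⟩ := exists_apart_not_mem_line hc hx hy hxy
  have h₁ : (2 : ℤ) ≤ _ := Nat.cast_le.mpr (h.two_le_card_compl_line hc hx hy hxy)
  have h₂ : (2 : ℤ) ≤ _ := Nat.cast_le.mpr (h.two_le_card_line hx hy hxy)
  have h₃ := (h.apart.mono (filter_subset (fun z => ¬ T x y z) S)).le_pairCount
    (x := x) (y := y) (by simp [hx, h.not_triple_left]) (by simp [hy, h.not_triple_right]) hxy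
  have h₄ := (h.apart.mono (filter_subset (fun z => T x y z) S)).le_pairCount
    (x := u) (y := v) (by simp [*]) (by simp [*]) huv
  rw [card_eq x y (T := T), h.pairCount_eq_line hx hy hxy]
  nlinarith

/-- This is f ≤ g + 2. It is immediate if every independent pair has at least three extensions;
otherwise some line has a complement C of just two points, and counting along that line suffices. -/
theorem three_mul_pairCount_le (h : IsPointLineGeometry D T S) (hc : NotLineUnionPoint D T S) :
    3 * pairCount D S S ≤ tripleCount T S S S + 12 := by
  by_cases h₃ : ∀ x ∈ S, ∀ y ∈ S, D x y → 3 ≤ #{z ∈ S | T x y z}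
  · have := pairCount_mul_le_tripleCount (T := T) (D := D) (A := S) (B := S) (C := S) (k := 3)
      fun x hx y hy hxy => by exact_mod_cast h₃ x hx y hy hxy
    linarith
  push Not at h₃
  obtain ⟨x, hx, y, hy, hxy, hlt⟩ := h₃
  obtain ⟨u, hu, v, hv, hTu, hTv, huv⟩ := exists_apart_not_mem_line hc hx hy hxy
  have hne : u ≠ v := fun he => h.apart.irrefl u (he ▸ huv)
  set C := {z ∈ S | T x y z}
  have hC : C = {u, v} := by
    refine (eq_of_subset_of_card_le ?_ ?_).symm
    · intro z hz
      rcases mem_insert.mp hz with rfl | hz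
      · simp [C, *]
      · rw [mem_singleton.mp hz]; simp [C, *]
    · rw [card_pair hne]; omega
  have hCcard : (#C : ℤ) = 2 := by rw [hC, card_pair hne]; rfl
  have hpair : pairCount D C C = 2 := by
    rw [pairCount_of_ne, hCcard]
    · norm_num
    · rw [hC]
      have := h.apart.symm
      have := h.apart.irrefl
      simp
      grind
  set L := {z ∈ S | ¬ T x y z} with hLdef
  have hxL : x ∈ L := by simp [hLdef, hx, h.not_triple_left]
  have hyL : y ∈ L := by simp [hLdef, hy, h.not_triple_right]
  have hLap : IsApartness D L := h.apart.mono (filter_subset _ _)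
  have hCCL := pairCount_mul_le_tripleCount (T := T) (D := D) (A := C) (B := C) (C := L)
    (k := #{z ∈ L | T u v z}) (by
      have hs : ∀ z, T v u z ↔ T u v z := fun z => ⟨h.swap_left _ _ _, h.swap_left _ _ _⟩
      have := h.apart.irrefl
      rw [hC]
      simp only [mem_insert, mem_singleton]
      rintro a (rfl | rfl) b (rfl | rfl) hab
      · exact absurd hab (this _)
      · rfl
      · simp_rw [hs]; rfl
      · exact absurd hab (this _))
  have hL : (#L : ℤ) = #{z ∈ L | ¬ T u v z} + #{z ∈ L | T u v z} := card_eq u v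
  -- What remains after the line decomposition with |C| = 2, using that u, v extend by every point
  -- of L off their own line.
  suffices key : 2 * (#L + #{z ∈ L | ¬ T u v z} : ℤ) ≤ pairCount D L L + 2 by
    rw [h.pairCount_eq_line hx hy hxy, h.tripleCount_eq_line hx hy hxy, hCcard, hpair]
    rw [hpair] at hCCL
    have := tripleCount_nonneg (T := T) (A := C) (B := C) (C := C)
    linarith
  rcases {z ∈ L | ¬ T u v z}.eq_empty_or_nonempty with he | ⟨w, hw⟩
  · rw [he]
    have := hLap.le_pairCount hxL hyL hxy
    simp only [card_empty, Nat.cast_zero]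
    linarith
  · rw [mem_filter] at hw
    obtain ⟨hwL, hTw⟩ := hw
    have hwS : w ∈ S := (mem_filter.mp hwL).1
    have hsub : (#{z ∈ L | ¬ T u v z} : ℤ) ≤ #{z ∈ L | ¬ D w z} := by
      refine Nat.cast_le.mpr (card_le_card fun z hz => ?_)
      simp only [hLdef, mem_filter] at hz hwL ⊢
      exact ⟨hz.1, h.not_apart_of_mem_inter hx hy hu hv hwS hz.1.1 hxy huv hTu hwL.2 hz.1.2
        hTw hz.2⟩
    have memL : ∀ p ∈ S, T u v p → p ∈ L := by
      intro p hp hTp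
      refine mem_filter.mpr ⟨hp, fun hpC => ?_⟩
      have : p ∈ C := mem_filter.mpr ⟨hp, hpC⟩
      rw [hC, mem_insert, mem_singleton] at this
      rcases this with rfl | rfl
      exacts [h.not_triple_left _ _ hTp, h.not_triple_right _ _ hTp]
    -- Covering fails for the line uv as well, so the points of L apart from w contain an apart
    -- pair. With class size α, rest β ≥ 2 and |L ∩ uv| ≤ α, the claim reduces to α + |L ∩ uv| ≤ αβ.
    obtain ⟨p, hp, hTp, hwp⟩ := hc u hu v hv w hwS huv
    obtain ⟨q, hq, hTq, hpq⟩ := hc u hu v hv p hp huv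
    have hwq := h.apart_of_not_triple hu hv hwS hq huv hTw hTq
    have hpB : p ∈ {z ∈ L | D w z} := mem_filter.mpr ⟨memL p hp hTp, hwp⟩
    have hqB : q ∈ {z ∈ L | D w z} := mem_filter.mpr ⟨memL q hq hTq, hwq⟩
    have hB := (hLap.mono (filter_subset (D w) L)).le_pairCount hpB hqB hpq
    have hB₂ : (2 : ℤ) ≤ #{z ∈ L | D w z} := by
      exact_mod_cast one_lt_card.mpr ⟨p, hpB, q, hqB, fun he => h.apart.irrefl p (he ▸ hpq)⟩
    have hA := hLap.one_le_card hwL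
    rw [hLap.pairCount_eq hwL]
    have := IsApartness.card_eq (L := L) (D := D) w
    nlinarith

/-- The case where some line has no coloop. -/
theorem six_mul_pairCount_le_of_line (h : IsPointLineGeometry D T S)
    (hc : NotLineUnionPoint D T S) (hx : x ∈ S) (hy : y ∈ S) (hxy : D x y)
    (h₂ : ∀ w ∈ {z ∈ S | ¬ T x y z}, 2 ≤ #{v ∈ {z ∈ S | ¬ T x y z} | D w v}) :
    6 * pairCount D S S + 48 ≤ tripleCount T S S S + 24 * #S := by
  have hE := (h.apart.mono (filter_subset (fun z => ¬ T x y z) S)).le_pairCount_of_two_le h₂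
  have hC : (2 : ℤ) ≤ _ := Nat.cast_le.mpr (h.two_le_card_compl_line hc hx hy hxy)
  have hCCL := pairCount_mul_le_tripleCount (T := T) (D := D) (A := {z ∈ S | T x y z})
    (B := {z ∈ S | T x y z}) (C := {z ∈ S | ¬ T x y z}) (k := 2) (by
      intro u hu v hv huv
      obtain ⟨hu, hTu⟩ := mem_filter.mp hu
      have hv := (mem_filter.mp hv).1
      rw [Nat.ofNat_le_cast]
      -- The line uv meets L within one parallel class, and at least two points of L are apart from
      -- that class.
      by_cases hw : ∃ w ∈ {z ∈ S | ¬ T x y z}, ¬ T u v w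
      · obtain ⟨w, hw, hTw⟩ := hw
        refine (h₂ w hw).trans (card_le_card fun z hz => ?_)
        simp only [mem_filter] at hw hz ⊢
        refine ⟨hz.1, by_contra fun hTz => ?_⟩
        exact h.not_apart_of_mem_inter hx hy hu hv hw.1 hz.1.1 hxy huv hTu hw.2 hz.1.2 hTw hTz
          hz.2
      · push Not at hw
        rw [filter_true_of_mem hw]
        exact h.two_le_card_line hx hy hxy)
  rw [card_eq x y (T := T), h.pairCount_eq_line hx hy hxy, h.tripleCount_eq_line hx hy hxy]
  -- The surplus is at least 3(c - 2)(d - 4(l - 2)), where l and c are the sizes of the line and its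
  -- complement and d counts the apart pairs in the line.
  nlinarith [tripleCount_nonneg (T := T) (A := {z ∈ S | T x y z}) (B := {z ∈ S | T x y z})
    (C := {z ∈ S | T x y z})]

/-- The case of a uniform matroid in which one element is replaced by a parallel class. -/
theorem six_mul_pairCount_le_of_uniform (h : IsPointLineGeometry D T S)
    (hc : NotLineUnionPoint D T S) (hx : x ∈ S) (hy : y ∈ S) (hxy : D x y)
    (hT : ∀ a ∈ S, ∀ b ∈ S, ∀ c ∈ S, D a b → D a c → D b c → T a b c)
    (hs : ∀ a ∈ S, ∀ b ∈ S, D x a → a ≠ b → D a b) :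
    6 * pairCount D S S + 48 ≤ tripleCount T S S S + 24 * #S := by
  set R := {z ∈ S | D x z} with hR
  set P := {z ∈ S | ¬ D x z} with hP
  have hp : (1 : ℤ) ≤ #P := h.apart.one_le_card hx
  have hr : (3 : ℤ) ≤ #R := by
    obtain ⟨u, hu, v, hv, hTu, hTv, huv⟩ := exists_apart_not_mem_line hc hx hy hxy
    have hxu := h.apart_of_not_triple hx hy hx hu hxy (h.not_triple_left _ _) hTu
    have hxv := h.apart_of_not_triple hx hy hx hv hxy (h.not_triple_left _ _) hTv
    have : 2 < #R := two_lt_card.mpr ⟨y, by simp [*], u, by simp [*], v, by simp [*],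
      fun he => h.not_triple_right x y (he ▸ hTu), fun he => h.not_triple_right x y (he ▸ hTv),
      fun he => h.apart.irrefl u (he ▸ huv)⟩
    exact_mod_cast this
  have hRR : pairCount D R R = #R * (#R - 1) := by
    refine pairCount_of_ne fun a ha b hb => ?_
    simp only [hR, mem_filter] at ha hb
    exact ⟨fun hd he => h.apart.irrefl a (he ▸ hd), hs a ha.1 b hb.1 ha.2⟩
  have hRRP := pairCount_mul_le_tripleCount (T := T) (D := D) (A := R) (B := R) (C := P)
    (k := #P) (by
      intro a ha b hb hab
      rw [filter_true_of_mem]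
      intro c hcP
      simp only [hR, hP, mem_filter] at ha hb hcP
      have hca : D c a := (h.apart.cotrans x hx c hcP.1 a ha.1 ha.2).resolve_left hcP.2
      have hcb : D c b := (h.apart.cotrans x hx c hcP.1 b hb.1 hb.2).resolve_left hcP.2
      exact hT a ha.1 b hb.1 c hcP.1 hab (h.apart.symm _ _ hca) (h.apart.symm _ _ hcb))
  have hRRR := pairCount_mul_le_tripleCount (T := T) (D := D) (A := R) (B := R) (C := R)
    (k := #R - 2) (by
      intro a ha b hb hab
      have hsub : (R.erase a).erase b ⊆ {c ∈ R | T a b c} := by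
        intro c hc
        simp only [mem_erase] at hc
        simp only [hR, mem_filter] at ha hb hc ⊢
        exact ⟨hc.2.2, hT a ha.1 b hb.1 c hc.2.2.1 hab (hs a ha.1 c hc.2.2.1 ha.2 hc.2.1.symm)
          (hs b hb.1 c hc.2.2.1 hb.2 hc.1.symm)⟩
      have := card_le_card hsub
      have hne : b ≠ a := by
        rintro rfl
        exact h.apart.irrefl b hab
      rw [card_erase_of_mem (mem_erase.mpr ⟨hne, hb⟩),
        card_erase_of_mem ha] at this
      omega)
  have hsplit := tripleCount_split (A := S) h.swap_left h.swap_right (D x)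
  rw [h.apart.pairCount_eq hx, hRR, IsApartness.card_eq (L := S) x (D := D), hsplit]
  have h₁ := tripleCount_nonneg (T := T) (A := P) (B := P) (C := R)
  have h₂ := tripleCount_nonneg (T := T) (A := P) (B := P) (C := P)
  rw [hRR] at hRRP hRRR
  change 6 * (2 * ((#P : ℤ) * #R) + #R * (#R - 1)) + 48 ≤ tripleCount T R R R +
    3 * tripleCount T R R P + 3 * tripleCount T P P R + tripleCount T P P P + 24 * (#P + #R)
  generalize (#P : ℤ) = p at *
  generalize (#R : ℤ) = r at *
  -- The counts reduce the claim to the sum of these two products being nonnegative.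
  have e₁ : 0 ≤ (p - 1) * (3 * (r * r - 5 * r + 8)) :=
    mul_nonneg (by linarith) (by nlinarith)
  have e₂ : 0 ≤ (r - 3) * (r * r - 3 * r + 8) := mul_nonneg (by linarith) (by nlinarith)
  nlinarith

/-- This is 2f + 8 ≤ g + 4m. If some line has no coloop, count along it. If every line has one, each
line is a parallel class plus a single element, and the matroid without its loops is uniform up to
one parallel class. -/
theorem six_mul_pairCount_le (h : IsPointLineGeometry D T S) (hc : NotLineUnionPoint D T S)
    (hx : x ∈ S) (hy : y ∈ S) (hxy : D x y) :
    6 * pairCount D S S + 48 ≤ tripleCount T S S S + 24 * #S := by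
  by_cases h₂ : ∃ x ∈ S, ∃ y ∈ S, D x y ∧
      ∀ w ∈ {z ∈ S | ¬ T x y z}, 2 ≤ #{v ∈ {z ∈ S | ¬ T x y z} | D w v}
  · obtain ⟨x, hx, y, hy, hxy, h₂⟩ := h₂
    exact h.six_mul_pairCount_le_of_line hc hx hy hxy h₂
  have hcol : ∀ x ∈ S, ∀ y ∈ S, D x y → ∃ w ∈ S, ∀ a ∈ S, ∀ b ∈ S, ¬ T x y a → ¬ T x y b →
      D w a → D w b → a = b := by
    intro x hx y hy hxy
    push Not at h₂
    obtain ⟨w, hw, hlt⟩ := h₂ x hx y hy hxy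
    refine ⟨w, (mem_filter.mp hw).1, fun a ha b hb hTa hTb hwa hwb => ?_⟩
    exact card_le_one.mp (Nat.lt_succ_iff.mp hlt) a (by simp [*]) b (by simp [*])
  -- The point w is apart from at least two of any three pairwise apart points, and on a common line
  -- these two would coincide.
  have hT : ∀ a ∈ S, ∀ b ∈ S, ∀ c ∈ S, D a b → D a c → D b c → T a b c := by
    intro a ha b hb c hcS hab hac hbc
    by_contra hTc
    obtain ⟨w, hw, heq⟩ := hcol a ha b hb hab
    have e₁ := heq a ha b hb (h.not_triple_left _ _) (h.not_triple_right _ _)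
    have e₂ := heq a ha c hcS (h.not_triple_left _ _) hTc
    have e₃ := heq b hb c hcS (h.not_triple_right _ _) hTc
    have c₁ := h.apart.cotrans a ha w hw b hb hab
    have c₂ := h.apart.cotrans a ha w hw c hcS hac
    have c₃ := h.apart.cotrans b hb w hw c hcS hbc
    have := h.apart.symm
    have := h.apart.irrefl
    grind
  -- At most one parallel class is nontrivial: w is apart from a or b, hence from both members of a
  -- parallel pair on the line ab.
  have hsing : ∀ a ∈ S, ∀ a' ∈ S, ∀ b ∈ S, ∀ b' ∈ S, a ≠ a' → ¬ D a a' → D a b → b ≠ b' →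
      D b b' := by
    intro a ha a' ha' b hb b' hb' hne hpar hab hne'
    by_contra hpar'
    obtain ⟨w, hw, heq⟩ := hcol a ha b hb hab
    have t₁ : ¬ T a b a' := fun ht =>
      hpar (h.apart_of_not_triple ha hb ha ha' hab (h.not_triple_left _ _) ht)
    have t₂ : ¬ T a b b' := fun ht =>
      hpar' (h.apart_of_not_triple ha hb hb hb' hab (h.not_triple_right _ _) ht)
    rcases h.apart.cotrans a ha w hw b hb hab with hd | hd
    · have hd := h.apart.symm _ _ hd
      have hd' := (h.apart.cotrans w hw a' ha' a ha hd).resolve_right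
        fun h' => hpar (h.apart.symm _ _ h')
      exact hne (heq a ha a' ha' (h.not_triple_left _ _) t₁ hd hd')
    · have hd' := (h.apart.cotrans w hw b' hb' b hb hd).resolve_right
        fun h' => hpar' (h.apart.symm _ _ h')
      exact hne' (heq b hb b' hb' (h.not_triple_right _ _) t₂ hd hd')
  by_cases hpar : ∃ a ∈ S, ∃ a' ∈ S, a ≠ a' ∧ ¬ D a a'
  · obtain ⟨a, ha, a', ha', hne, hpar⟩ := hpar
    obtain ⟨z, hz, -, haz⟩ := hc x hx y hy a ha hxy
    exact h.six_mul_pairCount_le_of_uniform hc ha hz haz hT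
      fun b hb b' hb' hab => hsing a ha a' ha' b hb b' hb' hne hpar hab
  · push Not at hpar
    exact h.six_mul_pairCount_le_of_uniform hc hx hy hxy hT fun a ha b hb _ => hpar a ha b hb

end IsPointLineGeometry

end PointLine

/-! ### From matroids to point-line counts -/

section Bridge

open scoped Classical
open Finset

variable {α : Type*}

/-- Double counting of the incidences x ∈ I; iterating it turns counts of sets into counts of
ordered tuples. -/
theorem succ_mul_card_filter_powersetCard (S : Finset α) (k : ℕ) (P : Finset α → Prop)
    [DecidablePred P] :
    (k + 1) * #{I ∈ powersetCard (k + 1) S | P I} =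
      ∑ x ∈ S, #{J ∈ powersetCard k S | x ∉ J ∧ P (insert x J)} := by
  have h := sum_card_bipartiteAbove_eq_sum_card_bipartiteBelow (s := S)
    (t := {I ∈ powersetCard (k + 1) S | P I}) (fun x I => x ∈ I)
  rw [sum_congr rfl (g := fun _ => k + 1) (s₁ := {I ∈ powersetCard (k + 1) S | P I})] at h
  · rw [sum_const, smul_eq_mul] at h
    rw [mul_comm, ← h]
    refine sum_congr rfl fun x hx => ?_
    refine card_nbij' (fun I => I.erase x) (fun J => insert x J) ?_ ?_ ?_ ?_
    · intro I hI
      simp only [bipartiteAbove, coe_filter, mem_filter, mem_powersetCard, Set.mem_ofPred_eq] at hI ⊢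
      refine ⟨⟨(erase_subset _ _).trans hI.1.1.1, ?_⟩, notMem_erase _ _, ?_⟩
      · rw [card_erase_of_mem hI.2, hI.1.1.2]; rfl
      · rw [insert_erase hI.2]; exact hI.1.2
    · intro J hJ
      simp only [bipartiteAbove, coe_filter, mem_filter, mem_powersetCard, Set.mem_ofPred_eq] at hJ ⊢
      refine ⟨⟨⟨insert_subset hx hJ.1.1, ?_⟩, hJ.2.2⟩, mem_insert_self _ _⟩
      rw [card_insert_of_notMem hJ.2.1, hJ.1.2]
    · intro I hI
      simp only [bipartiteAbove, coe_filter, mem_filter, Set.mem_ofPred_eq] at hI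
      exact insert_erase hI.2
    · intro J hJ
      simp only [coe_filter, Set.mem_ofPred_eq] at hJ
      exact erase_insert hJ.2.1
  · intro I hI
    simp only [mem_filter, mem_powersetCard] at hI
    rw [← hI.1.2]
    congr 1
    ext x
    simp only [bipartiteBelow, mem_filter]
    exact ⟨fun h => h.2, fun h => ⟨hI.1.1 h, h⟩⟩

theorem card_filter_powersetCard_one (S : Finset α) (P : Finset α → Prop)
    [DecidablePred P] :
    #{I ∈ powersetCard 1 S | P I} = ∑ x ∈ S, if P {x} then 1 else 0 := by
  have h := succ_mul_card_filter_powersetCard S 0 P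
  rw [zero_add, one_mul] at h
  rw [h]
  refine sum_congr rfl fun x _ => ?_
  rw [powersetCard_zero, filter_singleton]
  simp only [notMem_empty, not_false_eq_true, true_and, insert_empty_eq]
  split_ifs <;> simp

theorem two_mul_card_filter_powersetCard_two (S : Finset α) (P : Finset α → Prop)
    [DecidablePred P] :
    2 * #{I ∈ powersetCard 2 S | P I} =
      ∑ x ∈ S, ∑ y ∈ S, if x ≠ y ∧ P {x, y} then 1 else 0 := by
  rw [succ_mul_card_filter_powersetCard S 1 P]
  refine sum_congr rfl fun x _ => ?_
  rw [card_filter_powersetCard_one]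
  simp only [mem_singleton, ne_eq]

theorem six_mul_card_filter_powersetCard_three (S : Finset α) (P : Finset α → Prop)
    [DecidablePred P] :
    6 * #{I ∈ powersetCard 3 S | P I} =
      ∑ x ∈ S, ∑ y ∈ S, ∑ z ∈ S,
        if y ≠ z ∧ x ≠ y ∧ x ≠ z ∧ P {x, y, z} then 1 else 0 := by
  rw [show 6 = 2 * (2 + 1) from rfl, mul_assoc, succ_mul_card_filter_powersetCard S 2 P, mul_sum]
  refine sum_congr rfl fun x _ => ?_
  rw [two_mul_card_filter_powersetCard_two]
  simp only [mem_insert, mem_singleton, not_or, ne_eq, and_assoc]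

namespace Matroid

/-- The elements `x` and `y` are distinct and independent. -/
def IndepPair (M : Matroid α) (x y : α) : Prop := x ≠ y ∧ M.Indep {x, y}

/-- The elements `x`, `y` and `z` are distinct and independent. -/
def IndepTriple (M : Matroid α) (x y z : α) : Prop :=
  y ≠ z ∧ x ≠ y ∧ x ≠ z ∧ M.Indep {x, y, z}

variable {M : Matroid α} {x y z u v : α}

theorem IsNonloop.indepPair_iff (hx : M.IsNonloop x) (hy : M.IsNonloop y) :
    M.IndepPair x y ↔ y ∉ M.closure {x} := by
  rw [hx.indep.notMem_closure_iff hy.mem_ground, IndepPair, Set.pair_comm, Set.mem_singleton_iff,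
    and_comm, ne_comm]

theorem IndepPair.indepTriple_iff (h : M.IndepPair x y) (hz : M.IsNonloop z) :
    M.IndepTriple x y z ↔ z ∉ M.closure {x, y} := by
  rw [h.2.notMem_closure_iff hz.mem_ground, IndepTriple]
  have : ({x, y, z} : Set α) = insert z {x, y} := by ext; simp; tauto
  rw [this]
  have := h.1
  simp only [Set.mem_insert_iff, Set.mem_singleton_iff]
  grind

/-- In finite rank, a subset of a flat with the same rank spans that flat. -/
theorem IndepPair.closure_eq (h : M.IndepPair x y) (h' : M.IndepPair u v)
    (hu : u ∈ M.closure {x, y}) (hv : v ∈ M.closure {x, y}) :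
    M.closure {u, v} = M.closure {x, y} := by
  rw [← M.closure_closure {x, y}]
  refine IsRkFinite.closure_eq_closure_of_subset_of_eRk_ge_eRk ?_ ?_ ?_
  · exact M.isRkFinite_of_finite (Set.toFinite _)
  · rintro a (rfl | rfl)
    exacts [hu, hv]
  · rw [eRk_closure_eq, h.2.eRk_eq_encard, h'.2.eRk_eq_encard, Set.encard_pair h.1,
      Set.encard_pair h'.1]

variable (M) in
/-- The nonloops of a finite matroid. -/
noncomputable def nonloopFinset [M.Finite] : Finset α :=
  {x ∈ M.ground_finite.toFinset | M.IsNonloop x}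

theorem mem_nonloopFinset [M.Finite] : x ∈ M.nonloopFinset ↔ M.IsNonloop x := by
  simp only [nonloopFinset, mem_filter, Set.Finite.mem_toFinset, and_iff_right_iff_imp]
  exact fun h => h.mem_ground

theorem Indep.subset_nonloopFinset [M.Finite] {I : Finset α} (hI : M.Indep (I : Set α)) :
    I ⊆ M.nonloopFinset := fun _ hx => mem_nonloopFinset.mpr (hI.isNonloop_of_mem hx)

variable (M) in
theorem isPointLineGeometry [M.Finite] :
    IsPointLineGeometry M.IndepPair M.IndepTriple M.nonloopFinset where
  apart :=
    { symm := fun x y h => ⟨h.1.symm, by rw [Set.pair_comm]; exact h.2⟩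
      irrefl := fun x h => h.1 rfl
      cotrans := by
        intro x hx y hy z hz hxz
        rw [mem_nonloopFinset] at hx hy hz
        rw [hx.indepPair_iff hz] at hxz
        rw [hx.indepPair_iff hy, hy.indepPair_iff hz, ← not_and_or]
        rintro ⟨h₁, h₂⟩
        exact hxz (M.closure_subset_closure_of_subset_closure
          (Set.singleton_subset_iff.mpr h₁) h₂) }
  swap_left := fun x y z ⟨h₁, h₂, h₃, h₄⟩ =>
    ⟨h₃, h₂.symm, h₁, by rwa [Set.insert_comm] at h₄⟩
  swap_right := fun x y z ⟨h₁, h₂, h₃, h₄⟩ =>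
    ⟨h₁.symm, h₃, h₂, by rwa [Set.pair_comm] at h₄⟩
  pair_of_triple := fun x y z ⟨_, h₂, _, h₄⟩ =>
    ⟨h₂, h₄.subset (Set.insert_subset_insert (by simp))⟩
  line_eq := by
    intro x hx y hy u hu v hv hxy huv hu' hv' w hw
    rw [mem_nonloopFinset] at hu hv hw
    rw [hxy.indepTriple_iff hu, not_not] at hu'
    rw [hxy.indepTriple_iff hv, not_not] at hv'
    rw [hxy.indepTriple_iff hw, huv.indepTriple_iff hw, hxy.closure_eq huv hu' hv']

variable (M) in
/-- The number of independent sets of size `k`. -/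
noncomputable def indepCount [M.Finite] (k : ℕ) : ℕ :=
  #((powersetCard k M.nonloopFinset).filter fun I : Finset α => M.Indep (I : Set α))

theorem indepCount_zero [M.Finite] : M.indepCount 0 = 1 := by
  simp [indepCount, filter_singleton]

theorem indepCount_one [M.Finite] : M.indepCount 1 = #M.nonloopFinset := by
  rw [indepCount, card_filter_powersetCard_one, card_eq_sum_ones]
  refine sum_congr rfl fun x hx => if_pos ?_
  rw [coe_singleton]
  exact (mem_nonloopFinset.mp hx).indep

theorem two_mul_indepCount_two [M.Finite] :
    2 * (M.indepCount 2 : ℤ) = pairCount M.IndepPair M.nonloopFinset M.nonloopFinset := by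
  have h := two_mul_card_filter_powersetCard_two M.nonloopFinset fun I => M.Indep (I : Set α)
  zify at h
  unfold indepCount pairCount IndepPair
  convert h

theorem six_mul_indepCount_three [M.Finite] :
    6 * (M.indepCount 3 : ℤ) =
      tripleCount M.IndepTriple M.nonloopFinset M.nonloopFinset M.nonloopFinset := by
  have h := six_mul_card_filter_powersetCard_three M.nonloopFinset fun I => M.Indep (I : Set α)
  zify at h
  unfold indepCount tripleCount IndepTriple
  convert h

/-- Independent sets avoid loops and have at most r elements, so grouping them by size leaves a
common factor (1 - z) ^ (n - r), where n is the size of the ground set. -/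
theorem eval_reliability [M.Finite] {r : ℕ} (hM : M.eRank = r) (z : ℂ) :
    M.reliability.eval z = (1 - z) ^ (#M.ground_finite.toFinset - r) *
      ∑ k ∈ range (r + 1), M.indepCount k * (z ^ k * (1 - z) ^ (r - k)) := by
  have hr : r ≤ #M.ground_finite.toFinset := by
    have := M.eRank_le_encard_ground
    rw [hM, M.ground_finite.encard_eq_coe_toFinset_card] at this
    exact_mod_cast this
  have hcard {I : Finset α} (hI : M.Indep (I : Set α)) : #I ≤ r := by
    have := hI.encard_le_eRank
    rw [hM, Set.encard_coe_eq_coe_finsetCard] at this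
    exact_mod_cast this
  have hset : (M.ground_finite.toFinset.powerset.filter fun I : Finset α => M.Indep (I : Set α)) =
      (M.nonloopFinset.powerset.filter fun I : Finset α => M.Indep (I : Set α)) := by
    ext I
    simp only [mem_filter, mem_powerset, and_congr_left_iff]
    intro hI
    exact ⟨fun _ => hI.subset_nonloopFinset, fun h => h.trans (filter_subset _ _)⟩
  rw [reliability, Polynomial.eval_finsetSum, hset,
    ← sum_fiberwise_of_maps_to (t := range (r + 1)) (g := card), mul_sum]
  · refine sum_congr rfl fun k hk => ?_
    rw [mem_range, Nat.lt_succ_iff] at hk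
    rw [sum_congr rfl (g := fun _ => z ^ k * (1 - z) ^ (#M.ground_finite.toFinset - k)),
      sum_const, nsmul_eq_mul]
    · have hk' : #M.ground_finite.toFinset - k = (#M.ground_finite.toFinset - r) + (r - k) := by
        omega
      have hfib : ((M.nonloopFinset.powerset.filter fun I : Finset α =>
          M.Indep (I : Set α)).filter fun I => #I = k) =
          ((powersetCard k M.nonloopFinset).filter fun I : Finset α => M.Indep (I : Set α)) := by
        ext I
        simp only [mem_filter, mem_powerset, mem_powersetCard]
        tauto
      rw [hfib, hk', pow_add, indepCount]
      ring
    · intro I hI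
      simp only [mem_filter, mem_powerset] at hI
      have hsub : I ⊆ M.ground_finite.toFinset := hI.1.1.trans (filter_subset _ _)
      simp [card_sdiff_of_subset hsub, hI.2]
  · intro I hI
    rw [mem_filter] at hI
    exact mem_range.mpr (Nat.lt_succ_iff.mpr (hcard hI.2))

theorem exists_indepPair [M.Finite] (hM : M.eRank = 3) :
    ∃ x ∈ M.nonloopFinset, ∃ y ∈ M.nonloopFinset, M.IndepPair x y := by
  obtain ⟨B, hB⟩ := M.exists_isBase
  have hc : B.encard = 3 := by rw [hB.encard_eq_eRank, hM]
  obtain ⟨x, y, z, hxy, -, -, rfl⟩ := Set.encard_eq_three.mp hc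
  have hI : M.Indep {x, y} := hB.indep.subset (Set.insert_subset_insert (by simp))
  exact ⟨x, mem_nonloopFinset.mpr (hI.isNonloop_of_mem (by simp)),
    y, mem_nonloopFinset.mpr (hI.isNonloop_of_mem (by simp)), hxy, hI⟩

end Matroid

/-! ### From counts to roots -/

/-- The zeros of the product of the polynomials of a rank-one and a rank-two matroid. -/
theorem norm_le_one_of_product {p l e : ℤ} (hp : 0 ≤ p) (hl : 2 ≤ l)
    (he : e = l - 1 ∨ 2 * l - 4 ≤ e) (he' : l - 1 ≤ e) {z : ℂ}
    (hz : (1 - z) ^ 3 + (l + p) * (z * (1 - z) ^ 2) + (e + l * p) * (z ^ 2 * (1 - z)) +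
      e * p * z ^ 3 = 0) : ‖z‖ ≤ 1 := by
  have hfac : (1 + (p - 1 : ℂ) * z) * (1 + (l - 2 : ℂ) * z + (e - l + 1 : ℂ) * z ^ 2) = 0 := by
    linear_combination hz
  rcases mul_eq_zero.mp hfac with h | h
  · rcases hp.eq_or_lt with rfl | hp
    · have : z = 1 := by linear_combination -h + (Int.cast_zero (R := ℂ)) * z
      simp [this]
    · refine norm_le_one_of_quadratic_eq_zero (s := (p - 1 : ℤ)) (t := 0) ?_ (.inl rfl) ?_
      · rcases (show p - 1 = 0 ∨ 1 ≤ p - 1 by omega) with h | h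
        · exact .inl (by exact_mod_cast h)
        · exact .inr (by exact_mod_cast h)
      · push_cast
        linear_combination h
  · refine norm_le_one_of_quadratic_eq_zero (s := (l - 2 : ℤ)) (t := (e - l + 1 : ℤ)) ?_ ?_ ?_
    · rcases (show l - 2 = 0 ∨ 1 ≤ l - 2 by omega) with h | h
      · exact .inl (by exact_mod_cast h)
      · exact .inr (by exact_mod_cast h)
    · rcases (show e - l + 1 = 0 ∨ (1 ≤ e - l + 1 ∧ l - 2 ≤ e - l + 1 + 1) by omega) with h | h
      · exact .inl (by exact_mod_cast h)
      · exact .inr (by exact_mod_cast h)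
    · push_cast
      linear_combination h

/-- Expanding gives the h-vector, and the four hypotheses become, in order, those of the cubic
criterion. -/
theorem norm_le_one_of_counts {m f g : ℤ} (hm : 4 ≤ m) (hf : 2 * m - 2 ≤ f) (hfg : f ≤ g + 2)
    (hV : 2 * f + 8 ≤ g + 4 * m) {z : ℂ}
    (hz : (1 - z) ^ 3 + m * (z * (1 - z) ^ 2) + f * (z ^ 2 * (1 - z)) + g * z ^ 3 = 0) :
    ‖z‖ ≤ 1 := by
  refine norm_le_one_of_cubic_eq_zero (a := (m - 3 : ℤ)) (b := (f - 2 * m + 3 : ℤ))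
    (c := (g - f + m - 1 : ℤ)) ?_ ?_ ?_ ?_ ?_
  · exact_mod_cast (by omega : 1 ≤ m - 3)
  · exact_mod_cast (by omega : 1 ≤ f - 2 * m + 3)
  · exact_mod_cast (by omega : m - 3 ≤ g - f + m - 1)
  · exact_mod_cast (by omega : f - 2 * m + 3 + 1 ≤ g - f + m - 1 + (m - 3))
  · push_cast
    linear_combination hz

end Bridge

theorem theorem3p2 {α : Type*} (M : Matroid α) [M.Finite] (hM : M.eRank = 3) (z : ℂ)
    (hz : M.reliability.IsRoot z) : ‖z‖ ≤ 1 := by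
  classical
  by_cases hz1 : z = 1
  · simp [hz1]
  rw [Polynomial.IsRoot.def, M.eval_reliability (r := 3) (by exact_mod_cast hM)] at hz
  replace hz := (mul_eq_zero.mp hz).resolve_left (pow_ne_zero _ (sub_ne_zero.mpr (Ne.symm hz1)))
  simp only [Finset.sum_range_succ, Finset.sum_range_zero, Matroid.indepCount_zero,
    Matroid.indepCount_one] at hz
  have hG := M.isPointLineGeometry
  have h₂ := M.two_mul_indepCount_two
  have h₃ := M.six_mul_indepCount_three
  obtain ⟨x, hx, y, hy, hxy⟩ := Matroid.exists_indepPair hM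
  by_cases hc : NotLineUnionPoint M.IndepPair M.IndepTriple M.nonloopFinset
  · have e₁ := hG.four_le_card hc hx hy hxy
    have e₂ := hG.le_pairCount hc hx hy hxy
    have e₃ := hG.three_mul_pairCount_le hc
    have e₄ := hG.six_mul_pairCount_le hc hx hy hxy
    refine norm_le_one_of_counts (m := M.nonloopFinset.card) (f := M.indepCount 2)
      (g := M.indepCount 3) e₁ (by omega) (by omega) (by omega) ?_
    push_cast
    linear_combination hz
  · simp only [NotLineUnionPoint] at hc
    push Not at hc
    obtain ⟨u, hu, v, hv, w, hw, huv, hcov⟩ := hc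
    obtain ⟨c₂, c₃⟩ := hG.counts_of_line_union_point hu hv hw huv hcov
    have hcard := IsPointLineGeometry.card_eq (S := M.nonloopFinset) (T := M.IndepTriple) u v
    have hl := hG.two_le_card_line hu hv huv
    have hap := hG.apart.mono (Finset.filter_subset (fun z => ¬ M.IndepTriple u v z) _)
    have hu' : u ∈ M.nonloopFinset.filter (fun z => ¬ M.IndepTriple u v z) := by
      simp [hu, hG.not_triple_left]
    have hv' : v ∈ M.nonloopFinset.filter (fun z => ¬ M.IndepTriple u v z) := by
      simp [hv, hG.not_triple_right]
    have d₁ := hap.pairCount_eq_or_le hu' hv' huv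
    have d₂ := hap.le_pairCount hu' hv' huv
    set l := (M.nonloopFinset.filter (fun z => ¬ M.IndepTriple u v z)).card
    set p := (M.nonloopFinset.filter (fun z => M.IndepTriple u v z)).card
    -- The number of independent pairs inside the line. Defining it by subtraction makes the
    -- evenness of the ordered count automatic.
    obtain ⟨e, he⟩ : ∃ e : ℤ, e = M.indepCount 2 - l * p := ⟨_, rfl⟩
    have hE : pairCount M.IndepPair (M.nonloopFinset.filter fun z => ¬ M.IndepTriple u v z)
        (M.nonloopFinset.filter fun z => ¬ M.IndepTriple u v z) = 2 * e := by
      rw [he]; linarith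
    rw [hE] at c₂ c₃ d₁ d₂
    have g₂ : (M.indepCount 2 : ℤ) = e + l * p := by linarith
    have g₃ : (M.indepCount 3 : ℤ) = e * p := by linarith
    have i₁ := congrArg (Int.cast : ℤ → ℂ) hcard
    have i₂ := congrArg (Int.cast : ℤ → ℂ) g₂
    have i₃ := congrArg (Int.cast : ℤ → ℂ) g₃
    push_cast at i₁ i₂ i₃
    rw [i₁, i₂, i₃] at hz
    refine norm_le_one_of_product (p := p) (l := l) (e := e) (by omega) (by omega) (by omega)
      (by omega) ?_
    push_cast
    linear_combination hz
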